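/- Let $H$ be an infinite-dimensional complex Hilbert space. A bounded linear operator $T$ on $H$ is said to be of trace class, $T\in\boldsymbol{S}_1$, if $\sum_{i}\langle |T|e_i,e_i\rangle<\infty$ for some (equivalently, every) orthonormal basis $(e_i)$ of $H$, where $|T|=(T^*T)^{1/2}$. Then there exist compact self-adjoint operators $A$ and $B$ on $H$ such that $$A-B\in\boldsymbol{S}_1\quad\text{but}\quad |A|-|B|\notin\boldsymbol{S}_1 .$$ -/

import Mathlib

open scoped InnerProductSpace

/-- A bounded operator `T` on a complex Hilbert space is of trace class when the trace
`∑ ⟪eᵢ, |T| eᵢ⟫` of its absolute value `|T| = (T* T)^(1/2)` is finite, where `(eᵢ)` is an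
orthonormal basis. All the terms are nonnegative, and the sum does not depend on the basis:
see `isTraceClass_iff_of_hilbertBasis`. -/
def IsTraceClass {H : Type*} [NormedAddCommGroup H] [InnerProductSpace ℂ H] [CompleteSpace H]
    (T : H →L[ℂ] H) : Prop :=
  ∃ (s : Set H) (b : HilbertBasis s ℂ H), Summable fun i => (⟪b i, CFC.abs T (b i)⟫_ℂ).re

/-- Parseval's identity, for sums in `[0, ∞]`. -/
theorem tsum_enorm_inner_sq_hilbertBasis {H : Type*} [NormedAddCommGroup H]
    [InnerProductSpace ℂ H] {ι : Type*} (b : HilbertBasis ι ℂ H) (x : H) :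
    ∑' i, ENNReal.ofReal (‖⟪b i, x⟫_ℂ‖ ^ 2) = ENNReal.ofReal (‖x‖ ^ 2) := by
  have h := lp.hasSum_norm (p := 2) (by norm_num) (b.repr x)
  simp only [ENNReal.toReal_ofNat, Real.rpow_ofNat, b.repr.norm_map, b.repr_apply_apply] at h
  rw [← ENNReal.ofReal_tsum_of_nonneg (fun i => by positivity) h.summable, h.tsum_eq]

/-- The trace of a nonnegative operator, in `[0, ∞]`, is the same in any two orthonormal bases. -/
theorem tsum_re_inner_hilbertBasis_eq {H : Type*} [NormedAddCommGroup H] [InnerProductSpace ℂ H]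
    [CompleteSpace H] {ι κ : Type*} (b : HilbertBasis ι ℂ H) (c : HilbertBasis κ ℂ H)
    (P : H →L[ℂ] H) (hP : 0 ≤ P) :
    ∑' i, ENNReal.ofReal (⟪b i, P (b i)⟫_ℂ).re = ∑' j, ENNReal.ofReal (⟪c j, P (c j)⟫_ℂ).re := by
  have hS : ∀ x y, ⟪CFC.sqrt P x, y⟫_ℂ = ⟪x, CFC.sqrt P y⟫_ℂ :=
    ((ContinuousLinearMap.nonneg_iff_isPositive _).1 (CFC.sqrt_nonneg P)).isSymmetric
  have hsq : ∀ x, (⟪x, P x⟫_ℂ).re = ‖CFC.sqrt P x‖ ^ 2 := by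
    intro x
    have h1 : P x = CFC.sqrt P (CFC.sqrt P x) := by
      conv_lhs => rw [← CFC.sqrt_mul_sqrt_self P hP]
      rfl
    rw [h1, ← hS]
    exact inner_self_eq_norm_sq (𝕜 := ℂ) _
  simp only [hsq]
  calc ∑' i, ENNReal.ofReal (‖CFC.sqrt P (b i)‖ ^ 2)
      = ∑' i, ∑' j, ENNReal.ofReal (‖⟪c j, CFC.sqrt P (b i)⟫_ℂ‖ ^ 2) := by
        simp only [tsum_enorm_inner_sq_hilbertBasis]
    _ = ∑' j, ∑' i, ENNReal.ofReal (‖⟪b i, CFC.sqrt P (c j)⟫_ℂ‖ ^ 2) := by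
        rw [ENNReal.tsum_comm]
        refine tsum_congr fun j => tsum_congr fun i => ?_
        rw [← hS, norm_inner_symm]
    _ = ∑' j, ENNReal.ofReal (‖CFC.sqrt P (c j)‖ ^ 2) := by
        simp only [tsum_enorm_inner_sq_hilbertBasis]

/-- Any orthonormal basis may be used to decide whether an operator is of trace class. -/
theorem isTraceClass_iff_of_hilbertBasis {H : Type*} [NormedAddCommGroup H]
    [InnerProductSpace ℂ H] [CompleteSpace H] {ι : Type*} (b : HilbertBasis ι ℂ H)
    (T : H →L[ℂ] H) :
    IsTraceClass T ↔ Summable fun i => (⟪b i, CFC.abs T (b i)⟫_ℂ).re := by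
  have hT : 0 ≤ CFC.abs T := CFC.abs_nonneg T
  have h0 : ∀ x, 0 ≤ (⟪x, CFC.abs T x⟫_ℂ).re := fun x =>
    ((ContinuousLinearMap.nonneg_iff_isPositive _).1 hT).re_inner_nonneg_right x
  constructor
  · rintro ⟨s, c, h⟩
    have h1 := h.tsum_ofReal_ne_top
    rw [tsum_re_inner_hilbertBasis_eq c b _ hT] at h1
    exact (ENNReal.summable_toReal h1).congr fun i => ENNReal.toReal_ofReal (h0 _)
  · intro h
    obtain ⟨s, c, -⟩ := exists_hilbertBasis ℂ H
    have h1 := h.tsum_ofReal_ne_top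
    rw [tsum_re_inner_hilbertBasis_eq b c _ hT] at h1
    exact ⟨s, c, (ENNReal.summable_toReal h1).congr fun i => ENNReal.toReal_ofReal (h0 _)⟩

/-! The absolute value fails to preserve trace-class perturbations because triangular truncation is
unbounded in trace norm. Commutators suffice: with `U` the Cayley transform of a bounded
self-adjoint `Q` and `B = U* A U`, one has `|B| = U* |A| U`. Moreover `A - B` is `[A, Q]`, and `|A|
- |B|` is `[|A|, Q]`, up to invertible factors (`exists_isTraceClass_sub_of_commutator`).

Take `A = D ⊕ (-D)`, with `D` diagonal with eigenvalues `d i > 0`, and `Q` off-diagonal with entries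
`σ / (d i + d j)`. Then `[A, Q]` has entries `±σ`, of rank one in each copy of a block, whereas
`[|A|, Q]` has entries `σ (d i - d j) / (d i + d j)`. For `d i` proportional to `t ^ i` with `t`
small these approach `σ` times the triangular sign matrix. Its eigenvalues `(1 + z) / (1 - z)`, `z ^
N = -1`, have absolute sum of order `N log N`, against trace norm `N` for the constant matrix
(`exists_le_sum_norm_schur`). Blocks with growing ratio are scaled (`exists_block`) so that the
trace norms of the first commutator are summable and those of the second unbounded
(`traceNormLE_commutator`, `not_traceNormLE_commutator`).

Trace norms are handled by duality; `TraceNormLE.isTraceClass` and `IsTraceClass.exists_traceNormLE`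
translate to the definition. -/

/-! ### Trace norm bounds by duality with Bessel families -/

section TraceNorm

variable {H : Type*} [NormedAddCommGroup H] [InnerProductSpace ℂ H]

/-- A finite family of vectors satisfies Bessel's inequality with constant `a`. -/
def IsBesselWith {ι : Type*} [Fintype ι] (a : ℝ) (e : ι → H) : Prop :=
  ∀ x : H, ∑ i, ‖⟪e i, x⟫_ℂ‖ ^ 2 ≤ a ^ 2 * ‖x‖ ^ 2

theorem Orthonormal.isBesselWith {ι : Type*} [Fintype ι] {e : ι → H} (he : Orthonormal ℂ e) :
    IsBesselWith 1 e := fun x => by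
  simpa using he.sum_inner_products_le x (s := Finset.univ)

/-- This stability is why Bessel families replace orthonormal ones: a bounded factor of an operator
can be moved onto the test vectors. -/
theorem IsBesselWith.map [CompleteSpace H] {ι : Type*} [Fintype ι] {a c : ℝ} {e : ι → H}
    (he : IsBesselWith a e) (L : H →L[ℂ] H) (hL : ‖L‖ ≤ c) :
    IsBesselWith (a * c) (fun i => L (e i)) := fun x => by
  have hc : 0 ≤ c := (norm_nonneg _).trans hL
  have h1 : ‖(L.adjoint) x‖ ≤ c * ‖x‖ :=
    (L.adjoint.le_opNorm x).trans (by rw [LinearIsometryEquiv.norm_map]; gcongr)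
  calc ∑ i, ‖⟪L (e i), x⟫_ℂ‖ ^ 2 = ∑ i, ‖⟪e i, L.adjoint x⟫_ℂ‖ ^ 2 := by
        simp only [ContinuousLinearMap.adjoint_inner_right]
    _ ≤ a ^ 2 * ‖L.adjoint x‖ ^ 2 := he _
    _ ≤ a ^ 2 * (c * ‖x‖) ^ 2 := by gcongr
    _ = (a * c) ^ 2 * ‖x‖ ^ 2 := by ring

/-- The trace norm of `T` is at most `r`, tested on finite Bessel families. -/
def TraceNormLE (T : H →L[ℂ] H) (r : ℝ) : Prop :=
  ∀ (k : ℕ) (e f : Fin k → H) (a : ℝ), IsBesselWith a e → IsBesselWith a f →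
    ∑ i, ‖⟪e i, T (f i)⟫_ℂ‖ ≤ r * a ^ 2

theorem TraceNormLE.sum_le {T : H →L[ℂ] H} {r : ℝ} (hT : TraceNormLE T r) {ι : Type*} [Fintype ι]
    {a : ℝ} {e f : ι → H} (he : IsBesselWith a e) (hf : IsBesselWith a f) :
    ∑ i, ‖⟪e i, T (f i)⟫_ℂ‖ ≤ r * a ^ 2 := by
  let g := (Fintype.equivFin ι).symm
  have := hT _ (e ∘ g) (f ∘ g) a
    (fun x => by
      simpa using (Equiv.sum_comp g (fun i => ‖⟪e i, x⟫_ℂ‖ ^ 2)).le.trans (he x))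
    (fun x => by
      simpa using (Equiv.sum_comp g (fun i => ‖⟪f i, x⟫_ℂ‖ ^ 2)).le.trans (hf x))
  rwa [← Equiv.sum_comp g]

theorem TraceNormLE.mono {T : H →L[ℂ] H} {r s : ℝ} (hT : TraceNormLE T r) (h : r ≤ s) :
    TraceNormLE T s := fun k e f a he hf => (hT k e f a he hf).trans (by gcongr)

/-- Cauchy–Schwarz, then the Bessel inequality for each factor. -/
theorem traceNormLE_rankOne (x y : H) :
    TraceNormLE (InnerProductSpace.rankOne ℂ x y) (‖x‖ * ‖y‖) := by
  intro k e f a he hf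
  have h1 : ∀ i, ‖⟪e i, InnerProductSpace.rankOne ℂ x y (f i)⟫_ℂ‖
      = ‖⟪e i, x⟫_ℂ‖ * ‖⟪f i, y⟫_ℂ‖ := fun i => by
    rw [InnerProductSpace.rankOne_apply, inner_smul_right, norm_mul, norm_inner_symm y, mul_comm]
  simp only [h1]
  have h2 := Finset.sum_mul_sq_le_sq_mul_sq Finset.univ (fun i => ‖⟪e i, x⟫_ℂ‖)
    (fun i => ‖⟪f i, y⟫_ℂ‖)
  refine le_of_sq_le_sq (h2.trans ?_) (by positivity)
  calc _ ≤ (a ^ 2 * ‖x‖ ^ 2) * (a ^ 2 * ‖y‖ ^ 2) :=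
        mul_le_mul (he x) (hf y) (Finset.sum_nonneg fun _ _ => by positivity) (by positivity)
    _ = _ := by ring

theorem TraceNormLE.add {S T : H →L[ℂ] H} {r s : ℝ} (hS : TraceNormLE S r)
    (hT : TraceNormLE T s) : TraceNormLE (S + T) (r + s) := fun k e f a he hf => by
  calc ∑ i, ‖⟪e i, (S + T) (f i)⟫_ℂ‖
      ≤ ∑ i, (‖⟪e i, S (f i)⟫_ℂ‖ + ‖⟪e i, T (f i)⟫_ℂ‖) := by
        refine Finset.sum_le_sum fun i _ => ?_
        rw [add_apply, inner_add_right]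
        exact norm_add_le _ _
    _ ≤ r * a ^ 2 + s * a ^ 2 := by
        rw [Finset.sum_add_distrib]
        exact add_le_add (hS k e f a he hf) (hT k e f a he hf)
    _ = _ := by ring

theorem TraceNormLE.smul {T : H →L[ℂ] H} {r : ℝ} (hT : TraceNormLE T r) (z : ℂ) :
    TraceNormLE (z • T) (‖z‖ * r) := fun k e f a he hf => by
  simp only [smul_apply, inner_smul_right, norm_mul, ← Finset.mul_sum, mul_assoc]
  gcongr
  exact hT k e f a he hf

theorem traceNormLE_zero : TraceNormLE (0 : H →L[ℂ] H) 0 := fun k e f a _ _ => by simp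

theorem TraceNormLE.sum {ι : Type*} {T : ι → H →L[ℂ] H} {r : ι → ℝ} (s : Finset ι)
    (h : ∀ i ∈ s, TraceNormLE (T i) (r i)) : TraceNormLE (∑ i ∈ s, T i) (∑ i ∈ s, r i) := by
  classical
  induction s using Finset.induction_on with
  | empty => simpa using traceNormLE_zero
  | insert i s hi ih =>
    rw [Finset.sum_insert hi, Finset.sum_insert hi]
    exact (h i (by simp)).add (ih fun j hj => h j (by simp [hj]))

/-- For fixed finite test families the tested quantity is continuous in the operator, so bounds pass
to norm limits. -/
theorem TraceNormLE.hasSum {ι : Type*} {T : ι → H →L[ℂ] H} {r : ι → ℝ} {S : H →L[ℂ] H} {t : ℝ}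
    (h : ∀ i, TraceNormLE (T i) (r i)) (hT : HasSum T S) (hr : HasSum r t) :
    TraceNormLE S t := fun k e f a he hf => by
  have hc : Continuous fun S : H →L[ℂ] H => ∑ i, ‖⟪e i, S (f i)⟫_ℂ‖ := by fun_prop
  exact le_of_tendsto_of_tendsto' ((hc.tendsto S).comp hT) (Filter.Tendsto.mul_const (a ^ 2) hr)
    fun s => TraceNormLE.sum s (fun i _ => h i) k e f a he hf

/-- The maximum appears because both test families must share one Bessel constant. -/
theorem TraceNormLE.mul_mul [CompleteSpace H] {T : H →L[ℂ] H} {r : ℝ} (hT : TraceNormLE T r)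
    (L R : H →L[ℂ] H) : TraceNormLE (L * T * R) (r * (max ‖L‖ ‖R‖) ^ 2) := fun k e f a he hf => by
  have h := hT k _ _ _ (he.map L.adjoint (c := max ‖L‖ ‖R‖) (by simp))
    (hf.map R (c := max ‖L‖ ‖R‖) (by simp))
  simp only [ContinuousLinearMap.adjoint_inner_left] at h
  refine le_trans (le_of_eq rfl) (h.trans (by ring_nf; rfl))

/-- A self-adjoint operator with a bound on its trace norm is of trace class. -/
theorem TraceNormLE.isTraceClass [CompleteSpace H] {T : H →L[ℂ] H} {r : ℝ}
    (hT : TraceNormLE T r) (hsa : IsSelfAdjoint T) : IsTraceClass T := by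
  obtain ⟨s, b, hb⟩ := exists_hilbertBasis ℂ H
  refine ⟨s, b, ?_⟩
  have h0 : ∀ i, 0 ≤ (⟪b i, CFC.abs T (b i)⟫_ℂ).re := fun i =>
    ((ContinuousLinearMap.nonneg_iff_isPositive _).1 (CFC.abs_nonneg T)).re_inner_nonneg_right _
  refine summable_of_sum_le (c := r) h0 fun F => ?_
  have hbF : Orthonormal ℂ (fun i : F => b i) := b.orthonormal.comp _ Subtype.val_injective
  refine le_of_forall_pos_le_add fun δ hδ => ?_
  set ε : ℝ := δ / (F.card + 1) with hε
  have hεp : 0 < ε := by positivity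
  -- The function `t / (|t| + ε)` is a continuous substitute for the sign. It gives a contraction
  -- `C` with `|T| ≤ C T + ε`; the error over the `F.card` vectors is at most `δ`.
  have hden : ∀ t : ℝ, |t| + ε ≠ 0 := fun t => by positivity
  have hcont : Continuous fun t : ℝ => t / (|t| + ε) := by fun_prop (disch := exact hden _)
  let C : H →L[ℂ] H := cfc (fun t : ℝ => t / (|t| + ε)) T
  have hC : ‖C‖ ≤ 1 := norm_cfc_le zero_le_one fun t _ => by
    rw [Real.norm_eq_abs, abs_div, abs_of_pos (show 0 < |t| + ε by positivity)]
    exact div_le_one_of_le₀ (by linarith) (by positivity)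
  have hCT : CFC.abs T ≤ C * T + (ε : ℝ) • (1 : H →L[ℂ] H) := by
    have e1 : C * T + (ε : ℝ) • (1 : H →L[ℂ] H) =
        cfc (fun t : ℝ => t / (|t| + ε) * t + ε) T := by
      rw [cfc_add_const _ _ _ (by fun_prop), cfc_mul _ _ _ hcont.continuousOn (by fun_prop),
        cfc_id' ℝ T, Algebra.algebraMap_eq_smul_one]
    rw [e1, CFC.abs_eq_cfc_norm T]
    refine cfc_mono (fun t _ => ?_) (by fun_prop) (by fun_prop)
    rw [Real.norm_eq_abs, div_mul_eq_mul_div, div_add' _ _ _ (hden t), le_div_iff₀ (by positivity)]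
    nlinarith [abs_mul_abs_self t, abs_nonneg t]
  have h1 : ∀ i, (⟪b i, CFC.abs T (b i)⟫_ℂ).re ≤ ‖⟪b i, (C * T) (b i)⟫_ℂ‖ + ε := fun i => by
    have := ((ContinuousLinearMap.le_def _ _).1 hCT).re_inner_nonneg_right (b i)
    simp only [sub_apply, add_apply, smul_apply, inner_sub_right, inner_add_right] at this
    have hbi : ‖b i‖ = 1 := b.orthonormal.1 i
    have h2 : ⟪b i, ε • (1 : H →L[ℂ] H) (b i)⟫_ℂ = ε := by
      simp [inner_smul_right_eq_smul, inner_self_eq_norm_sq_to_K, hbi]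
    rw [h2] at this
    have h3 := Complex.re_le_norm ⟪b i, (C * T) (b i)⟫_ℂ
    simp at this h3 ⊢
    linarith
  have hCb : IsBesselWith 1 (fun i : F => C.adjoint (b i)) := by
    simpa using hbF.isBesselWith.map C.adjoint (c := 1) (by simpa using hC)
  have h2 := hT.sum_le hCb hbF.isBesselWith
  simp only [ContinuousLinearMap.adjoint_inner_left] at h2
  calc ∑ i ∈ F, (⟪b i, CFC.abs T (b i)⟫_ℂ).re ≤ ∑ i ∈ F, (‖⟪b i, (C * T) (b i)⟫_ℂ‖ + ε) :=
        Finset.sum_le_sum fun i _ => h1 i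
    _ = ∑ i : F, ‖⟪b i, C (T (b i))⟫_ℂ‖ + F.card * ε := by
        rw [Finset.sum_add_distrib, Finset.sum_coe_sort F (fun i => ‖⟪b i, C (T (b i))⟫_ℂ‖)]
        simp
    _ ≤ r + δ := by
        gcongr
        · simpa using h2
        · rw [hε, mul_div_assoc', div_le_iff₀ (by positivity)]
          nlinarith

/-- The sum of a nonnegative quadratic form over a Bessel family is controlled by the trace. -/
theorem IsBesselWith.sum_re_inner_le [CompleteSpace H] {ι κ : Type*} [Fintype ι] {a : ℝ}
    {e : ι → H} (he : IsBesselWith a e) {P : H →L[ℂ] H} (hP : 0 ≤ P) (b : HilbertBasis κ ℂ H)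
    (hs : Summable fun j => (⟪b j, P (b j)⟫_ℂ).re) :
    ∑ i, (⟪e i, P (e i)⟫_ℂ).re ≤ a ^ 2 * ∑' j, (⟪b j, P (b j)⟫_ℂ).re := by
  have hS : ∀ x y, ⟪CFC.sqrt P x, y⟫_ℂ = ⟪x, CFC.sqrt P y⟫_ℂ :=
    ((ContinuousLinearMap.nonneg_iff_isPositive _).1 (CFC.sqrt_nonneg P)).isSymmetric
  have hsq : ∀ x, (⟪x, P x⟫_ℂ).re = ‖CFC.sqrt P x‖ ^ 2 := by
    intro x
    have h1 : P x = CFC.sqrt P (CFC.sqrt P x) := by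
      conv_lhs => rw [← CFC.sqrt_mul_sqrt_self P hP]
      rfl
    rw [h1, ← hS]
    exact inner_self_eq_norm_sq (𝕜 := ℂ) _
  simp only [hsq] at hs ⊢
  have h1 : ∀ x : H, HasSum (fun j => ‖⟪b j, x⟫_ℂ‖ ^ 2) (‖x‖ ^ 2) := fun x => by
    have h := lp.hasSum_norm (p := 2) (by norm_num) (b.repr x)
    simpa only [ENNReal.toReal_ofNat, Real.rpow_ofNat, b.repr.norm_map, b.repr_apply_apply] using h
  -- Parseval in `b` turns the sum into a double sum; by symmetry of the square root, Bessel for `e`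
  -- then applies to each `√P (b j)`.
  have h2 : HasSum (fun j => ∑ i, ‖⟪b j, CFC.sqrt P (e i)⟫_ℂ‖ ^ 2) (∑ i, ‖CFC.sqrt P (e i)‖ ^ 2) :=
    hasSum_sum fun i _ => h1 _
  rw [← h2.tsum_eq, ← tsum_mul_left]
  refine h2.summable.tsum_le_tsum (fun j => ?_) (hs.mul_left _)
  have h3 : ∀ i, ‖⟪b j, CFC.sqrt P (e i)⟫_ℂ‖ = ‖⟪e i, CFC.sqrt P (b j)⟫_ℂ‖ := fun i => by
    rw [← hS, norm_inner_symm]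
  simp only [h3]
  exact he _

/-- A self-adjoint operator of trace class has finite trace norm. -/
theorem IsTraceClass.exists_traceNormLE [CompleteSpace H] {T : H →L[ℂ] H} (hT : IsTraceClass T)
    (hsa : IsSelfAdjoint T) : ∃ r, TraceNormLE T r := by
  obtain ⟨s, b, hs⟩ := hT
  refine ⟨∑' j, (⟪b j, CFC.abs T (b j)⟫_ℂ).re, fun k e f a he hf => ?_⟩
  have hP : 0 ≤ CFC.abs T := CFC.abs_nonneg T
  have hpos : T ≤ CFC.abs T := by
    rw [← sub_nonneg, CFC.abs_sub_self T]
    exact nsmul_nonneg (CFC.negPart_nonneg T) 2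
  have hneg : -T ≤ CFC.abs T := by
    rw [← sub_nonneg, sub_neg_eq_add, CFC.abs_add_self T]
    exact nsmul_nonneg (CFC.posPart_nonneg T) 2
  have hsymm : ∀ x y, ⟪T x, y⟫_ℂ = ⟪x, T y⟫_ℂ := hsa.isSymmetric
  have hre : ∀ x y, 2 * (⟪x, T y⟫_ℂ).re ≤
      (⟪x, CFC.abs T x⟫_ℂ).re + (⟪y, CFC.abs T y⟫_ℂ).re := fun x y => by
    -- Polarisation: in the sum of the two inequalities the cross terms of `|T|` cancel and those of
    -- `T` add up.
    have h1 := ((ContinuousLinearMap.le_def _ _).1 hpos).re_inner_nonneg_right (x + y)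
    have h2 := ((ContinuousLinearMap.le_def _ _).1 hneg).re_inner_nonneg_right (x - y)
    have e1 : (⟪y, T x⟫_ℂ).re = (⟪x, T y⟫_ℂ).re := by
      rw [← hsymm, ← inner_conj_symm, Complex.conj_re]
    simp only [sub_apply, neg_apply, map_add, map_sub, inner_add_left, inner_add_right,
      inner_sub_left, inner_sub_right, inner_neg_right, RCLike.re_to_complex, Complex.sub_re,
      Complex.neg_re] at h1 h2
    linarith
  have hnorm : ∀ x y, 2 * ‖⟪x, T y⟫_ℂ‖ ≤
      (⟪x, CFC.abs T x⟫_ℂ).re + (⟪y, CFC.abs T y⟫_ℂ).re := fun x y => by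
    -- Rotating `y` by a phase makes the inner product real and nonnegative, without changing the
    -- diagonal terms.
    obtain ⟨u, hu, hu'⟩ := Complex.exists_norm_mul_eq_self ⟪x, T y⟫_ℂ
    have hc : starRingEnd ℂ u * u = 1 := by
      rw [mul_comm, Complex.mul_conj, Complex.normSq_eq_norm_sq, hu]; simp
    have h1 := hre x (starRingEnd ℂ u • y)
    have e1 : ⟪x, T (starRingEnd ℂ u • y)⟫_ℂ = (‖⟪x, T y⟫_ℂ‖ : ℂ) := by
      rw [map_smul, inner_smul_right]
      nth_rw 1 [← hu']
      rw [← mul_assoc, hc, one_mul]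
    have e2 : ⟪starRingEnd ℂ u • y, CFC.abs T (starRingEnd ℂ u • y)⟫_ℂ = ⟪y, CFC.abs T y⟫_ℂ := by
      rw [map_smul, inner_smul_right, inner_smul_left, Complex.conj_conj, ← mul_assoc, hc, one_mul]
    rwa [e1, e2, Complex.ofReal_re] at h1
  have h1 := he.sum_re_inner_le hP b hs
  have h2 := hf.sum_re_inner_le hP b hs
  have h3 := Finset.sum_le_sum fun i (_ : i ∈ Finset.univ) => hnorm (e i) (f i)
  rw [Finset.sum_add_distrib, ← Finset.mul_sum] at h3
  linarith

end TraceNorm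

/-! ### From commutators to differences: the Cayley transform -/

section Cayley

variable {H : Type*} [NormedAddCommGroup H] [InnerProductSpace ℂ H] [CompleteSpace H]

/-- For the Cayley transform `U = N* N⁻¹`, `N = -i - Q`, of a self-adjoint `Q`, the commutators with
`U` and with `Q` are proportional up to invertible factors. -/
theorem exists_unitary_commutator {Q : H →L[ℂ] H} (hQ : IsSelfAdjoint Q) :
    ∃ U R N : H →L[ℂ] H, U ∈ unitary (H →L[ℂ] H) ∧
      (∀ A, U * A - A * U = (-2 * Complex.I) • (R * (A * Q - Q * A) * R)) ∧
      N * R = 1 ∧ R * N = 1 := by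
  obtain ⟨u, hu⟩ : IsUnit (algebraMap ℂ (H →L[ℂ] H) (-Complex.I) - Q) := by
    rw [← spectrum.notMem_iff]
    intro h
    simpa using hQ.im_eq_zero_of_mem_spectrum h
  set N : H →L[ℂ] H := (u : H →L[ℂ] H) with hN
  set R : H →L[ℂ] H := (↑u⁻¹ : H →L[ℂ] H) with hR
  have hNR : N * R = 1 := u.mul_inv
  have hRN : R * N = 1 := u.inv_mul
  have hsN : star N = algebraMap ℂ (H →L[ℂ] H) Complex.I - Q := by
    rw [hu, star_sub, hQ.star_eq, ← algebraMap_star_comm]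
    simp
  have hsN' : star N = N + (2 * Complex.I) • 1 := by
    rw [hsN, hu, Algebra.algebraMap_eq_smul_one, Algebra.algebraMap_eq_smul_one, two_mul,
      add_smul, neg_smul]
    abel
  have hcomm : star N * N = N * star N := by
    rw [hsN', add_mul, mul_add, smul_one_mul, mul_smul_one]
  have hRs : star R * star N = 1 := by rw [← star_mul, hNR, star_one]
  have hRs' : star N * star R = 1 := by rw [← star_mul, hRN, star_one]
  -- Hence `[U, A] = 2i [R, A]`, and the commutator with the inverse `R` of `N` is `R [A, N] R`.
  have hU : star N * R = 1 + (2 * Complex.I) • R := by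
    rw [hsN', add_mul, hNR, smul_mul_assoc, one_mul]
  have hQN : Q = algebraMap ℂ (H →L[ℂ] H) (-Complex.I) - N := by rw [hu]; abel
  refine ⟨star N * R, R, N, ?_, fun A => ?_, hNR, hRN⟩
  · rw [Unitary.mem_iff, star_mul, star_star]
    constructor
    · calc star R * N * (star N * R) = star R * (N * star N) * R := by simp only [mul_assoc]
        _ = (star R * star N) * (N * R) := by rw [← hcomm]; simp only [mul_assoc]
        _ = 1 := by rw [hRs, hNR, one_mul]
    · have h1 : R * star R = star R * R := by
        have h3 : R * star R * (star N * N) = 1 := by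
          rw [mul_assoc, ← mul_assoc (star R), hRs, one_mul, hRN]
        have h4 : (star N * N) * (star R * R) = 1 := by
          rw [hcomm, mul_assoc, ← mul_assoc (star N), hRs', one_mul, hNR]
        exact left_inv_eq_right_inv h3 h4
      calc star N * R * (star R * N) = star N * (R * star R) * N := by simp only [mul_assoc]
        _ = (star N * star R) * (R * N) := by rw [h1]; simp only [mul_assoc]
        _ = 1 := by rw [hRs', hRN, one_mul]
  · have h1 : A * Q - Q * A = N * A - A * N := by
      rw [hQN, mul_sub, sub_mul, Algebra.commutes]
      abel
    have h2 : R * (N * A - A * N) * R = A * R - R * A := by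
      rw [mul_sub, sub_mul, ← mul_assoc, hRN, one_mul, mul_assoc R, mul_assoc A, hNR, mul_one]
    rw [h1, h2, hU, add_mul, mul_add, one_mul, mul_one, smul_mul_assoc, mul_smul_comm, smul_sub,
      neg_mul, neg_smul, neg_smul]
    abel

theorem abs_star_mul_mul_unitary {A P U : H →L[ℂ] H} (hP : CFC.abs A = P)
    (hU : U ∈ unitary (H →L[ℂ] H)) : CFC.abs (star U * A * U) = star U * P * U := by
  have h1 : U * star U = 1 := Unitary.mul_star_self_of_mem hU
  subst hP
  refine CFC.sqrt_unique ?_ (star_left_conjugate_nonneg (CFC.abs_nonneg A) U)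
  calc star U * CFC.abs A * U * (star U * CFC.abs A * U)
      = star U * CFC.abs A * (U * star U) * CFC.abs A * U := by simp only [mul_assoc]
    _ = star U * (CFC.abs A * CFC.abs A) * U := by rw [h1, mul_one]; simp only [mul_assoc]
    _ = star U * star A * (U * star U) * A * U := by
        rw [CFC.abs_mul_abs, h1, mul_one]; simp only [mul_assoc]
    _ = star (star U * A * U) * (star U * A * U) := by
        simp only [star_mul, star_star, mul_assoc]

/-- Operators whose commutator with a bounded self-adjoint operator has finite trace norm, while the
commutator of the absolute value does not, give the required pair. -/
theorem exists_isTraceClass_sub_of_commutator {A P Q : H →L[ℂ] H} (hA : IsSelfAdjoint A)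
    (hAc : IsCompactOperator A) (hP : CFC.abs A = P) (hQ : IsSelfAdjoint Q) {r : ℝ}
    (h1 : TraceNormLE (A * Q - Q * A) r) (h2 : ∀ s, ¬ TraceNormLE (P * Q - Q * P) s) :
    ∃ B : H →L[ℂ] H, IsCompactOperator B ∧ IsSelfAdjoint B ∧
      IsTraceClass (A - B) ∧ ¬ IsTraceClass (CFC.abs A - CFC.abs B) := by
  obtain ⟨U, R, N, hU, hcom, hNR, hRN⟩ := exists_unitary_commutator hQ
  have hUU : star U * U = 1 := Unitary.star_mul_self_of_mem hU
  have hUU' : U * star U = 1 := Unitary.mul_star_self_of_mem hU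
  have hB : IsSelfAdjoint (star U * A * U) := by
    rw [IsSelfAdjoint, star_mul, star_mul, star_star, hA.star_eq, mul_assoc]
  have hdiff : ∀ X : H →L[ℂ] H, X - star U * X * U = star U * (U * X - X * U) := fun X => by
    rw [mul_sub, ← mul_assoc, hUU, one_mul, mul_assoc]
  refine ⟨star U * A * U, (hAc.clm_comp (star U)).comp_clm U, hB, ?_, fun h => ?_⟩
  · have h3 := (h1.mul_mul (star U * R) R).smul (-2 * Complex.I)
    rw [mul_assoc (star U), mul_assoc (star U), ← mul_smul_comm, ← hcom, ← hdiff] at h3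
    exact h3.isTraceClass (hA.sub hB)
  · have hPsa : IsSelfAdjoint P := hP ▸ (CFC.abs_nonneg A).isSelfAdjoint
    rw [abs_star_mul_mul_unitary hP hU, hP] at h
    obtain ⟨s, hs⟩ := h.exists_traceNormLE
      (hPsa.sub (by rw [IsSelfAdjoint, star_mul, star_mul, star_star, hPsa.star_eq, mul_assoc]))
    -- Since `U`, `R` are invertible, the commutator is recovered from the difference, so a trace
    -- norm bound for the latter would bound the former.
    have key : P * Q - Q * P = (Complex.I / 2) • (N * U * (P - star U * P * U) * N) := by
      rw [hdiff, hcom]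
      have : N * U * (star U * ((-2 * Complex.I) • (R * (P * Q - Q * P) * R))) * N
          = (-2 * Complex.I) • (P * Q - Q * P) := by
        rw [mul_smul_comm, mul_smul_comm, smul_mul_assoc]
        congr 1
        calc _ = N * (U * star U) * R * (P * Q - Q * P) * (R * N) := by simp only [mul_assoc]
          _ = _ := by rw [hUU', mul_one, hNR, hRN, one_mul, mul_one]
      rw [this, smul_smul, show Complex.I / 2 * (-2 * Complex.I) = 1 by
        linear_combination -Complex.I_mul_I, one_smul]
    have h3 := (hs.mul_mul (N * U) N).smul (Complex.I / 2)
    rw [← key] at h3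
    exact h2 _ h3

end Cayley

/-! ### The triangular sign matrix and the block parameters -/

section SkewCirculant

open Filter Topology

/-- The triangular sign matrix acts on the powers of an `N`-th root of `-1` as a scalar. -/
theorem one_sub_mul_sum_sign_mul_pow {N : ℕ} {z : ℂ} (hz : z ^ N = -1) {i : ℕ} (hi : i < N) :
    (1 - z) * ∑ j ∈ Finset.range N, (if i < j then 1 else if j < i then -1 else 0 : ℂ) * z ^ j
      = z ^ i * (1 + z) := by
  -- The sum telescopes along `g` except at `j = i`; the boundary terms cancel since `z ^ N = -1`.
  let g : ℕ → ℂ := fun j => if j ≤ i then -z ^ j else z ^ j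
  have h1 : ∀ j, (1 - z) * ((if i < j then 1 else if j < i then -1 else 0 : ℂ) * z ^ j)
      = (g j - g (j + 1)) + if i = j then z ^ i * (1 + z) else 0 := by
    intro j
    simp only [g]
    rcases lt_trichotomy i j with h | h | h
    · rw [if_pos h, if_neg (by omega), if_neg (by omega), if_neg (by omega)]
      ring
    · subst h
      simp
      ring
    · rw [if_neg (by omega), if_pos h, if_pos (by omega), if_pos (by omega), if_neg (by omega)]
      ring
  rw [Finset.mul_sum, Finset.sum_congr rfl fun j _ => h1 j, Finset.sum_add_distrib,
    Finset.sum_range_sub', Finset.sum_ite_eq, if_pos (by simpa using hi)]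
  simp only [g]
  rw [if_pos (by omega), if_neg (by omega), hz]
  ring

/-- The `N`-th roots of `-1`. -/
noncomputable def skewRoot (N k : ℕ) : ℂ := Complex.exp (Complex.I * ((2 * k + 1) * Real.pi / N : ℝ))

theorem norm_skewRoot (N k : ℕ) : ‖skewRoot N k‖ = 1 := Complex.norm_exp_I_mul_ofReal _

theorem skewRoot_pow {N : ℕ} (hN : 0 < N) (k : ℕ) : skewRoot N k ^ N = -1 := by
  have hN' : (N : ℂ) ≠ 0 := by exact_mod_cast hN.ne'
  rw [skewRoot, ← Complex.exp_nat_mul]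
  have : (N : ℂ) * (Complex.I * ((2 * k + 1) * Real.pi / N : ℝ))
      = Real.pi * Complex.I + k * (2 * Real.pi * Complex.I) := by
    push_cast
    field_simp
    ring
  rw [this, Complex.exp_add, Complex.exp_pi_mul_I, Complex.exp_nat_mul_two_pi_mul_I, mul_one]

/-- The quotient of two `N`-th roots of `-1` is an `N`-th root of unity, whose geometric sum
vanishes unless it is `1`. -/
theorem sum_conj_skewRoot_pow_mul {N k l : ℕ} (hk : k < N) (hl : l < N) :
    ∑ j ∈ Finset.range N, starRingEnd ℂ (skewRoot N k ^ j) * skewRoot N l ^ j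
      = if k = l then (N : ℂ) else 0 := by
  have hN : 0 < N := by omega
  have hN' : (N : ℂ) ≠ 0 := by exact_mod_cast hN.ne'
  simp only [map_pow, ← mul_pow]
  split_ifs with h
  · subst h
    simp [← Complex.normSq_eq_conj_mul_self, Complex.normSq_eq_norm_sq, norm_skewRoot]
  · set z := starRingEnd ℂ (skewRoot N k) * skewRoot N l with hz
    have hzN : z ^ N = 1 := by
      rw [hz, mul_pow, ← map_pow, skewRoot_pow hN, skewRoot_pow hN]; simp
    have hz1 : z ≠ 1 := by
      intro h1
      rw [hz, skewRoot, skewRoot, ← Complex.exp_conj, ← Complex.exp_add,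
        Complex.exp_eq_one_iff] at h1
      obtain ⟨n, hn⟩ := h1
      have hpi : (Real.pi : ℂ) ≠ 0 := by exact_mod_cast Real.pi_ne_zero
      rw [map_mul, Complex.conj_I, Complex.conj_ofReal] at hn
      push_cast at hn
      have h2 : (l : ℂ) - k = n * N := by
        have h3 : (2 * Real.pi * Complex.I) * ((l : ℂ) - k) = (2 * Real.pi * Complex.I) * (n * N) := by
          field_simp at hn
          linear_combination (Real.pi * Complex.I) * hn
        exact mul_left_cancel₀ (by simp [hpi]) h3
      have h4 : (l : ℤ) - k = n * N := by exact_mod_cast h2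
      have hn0 : n = 0 := by
        by_contra hne
        have : (N : ℤ) ≤ |n * N| := by
          rw [abs_mul, Nat.abs_cast]
          exact le_mul_of_one_le_left (by positivity) (Int.one_le_abs hne)
        rw [← h4] at this
        rcases abs_cases ((l : ℤ) - k) with h5 | h5 <;> omega
      rw [hn0] at h4
      omega
    have := mul_neg_geom_sum z N
    rw [hzN, sub_self] at this
    exact (mul_eq_zero.1 this).resolve_left (sub_ne_zero.2 hz1.symm)

/-- With `θ` the argument, the chord satisfies `|1 - z| ≤ θ`, hence `|1 + z| ≥ 2 - θ`. Summed over
`k`, these bounds yield the harmonic series. -/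
theorem norm_one_add_div_one_sub_skewRoot {N k : ℕ} (hk : k < N) :
    N / (Real.pi * (k + 1)) - 1 ≤ ‖(1 + skewRoot N k) / (1 - skewRoot N k)‖ := by
  have hN : 0 < N := by omega
  have hN' : (0 : ℝ) < N := by exact_mod_cast hN
  set θ : ℝ := (2 * k + 1) * Real.pi / N with hθ
  have hθp : 0 < θ := by positivity
  have h1 : ‖1 - skewRoot N k‖ ≤ θ := by
    rw [norm_sub_rev]
    have := Real.norm_exp_I_mul_ofReal_sub_one_le (x := θ)
    rwa [Real.norm_of_nonneg hθp.le] at this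
  have h2 : 2 - θ ≤ ‖1 + skewRoot N k‖ := by
    have h3 : ‖(2 : ℂ)‖ ≤ ‖1 + skewRoot N k‖ + ‖1 - skewRoot N k‖ := by
      refine le_trans (le_of_eq ?_) (norm_add_le _ _)
      congr 1
      ring
    rw [Complex.norm_ofNat] at h3
    linarith
  have h0 : 0 < ‖1 - skewRoot N k‖ := by
    rw [norm_pos_iff, sub_ne_zero]
    intro h
    have := skewRoot_pow hN k
    rw [← h, one_pow] at this
    norm_num at this
  rw [norm_div]
  have h4 : (N : ℝ) / (Real.pi * (k + 1)) ≤ 2 / θ := by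
    rw [hθ, div_div_eq_mul_div, div_le_div_iff₀ (by positivity) (by positivity)]
    have : 0 ≤ N * Real.pi := by positivity
    nlinarith
  have h5 : 2 / θ - 1 = (2 - θ) / θ := by field_simp
  refine le_trans (by linarith [h5.le]) (?_ : (2 - θ) / θ ≤ _)
  rcases le_total 0 (2 - θ) with h6 | h6
  · exact div_le_div₀ (norm_nonneg _) h2 h0 h1
  · exact (div_nonpos_of_nonpos_of_nonneg h6 hθp.le).trans (by positivity)

theorem sum_conj_skewRoot_mul_sign {N k : ℕ} (hk : k < N) :
    ∑ i ∈ Finset.range N, ∑ j ∈ Finset.range N, starRingEnd ℂ (skewRoot N k ^ i) *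
      ((if i < j then 1 else if j < i then -1 else 0 : ℝ) : ℂ) * skewRoot N k ^ j
      = N * ((1 + skewRoot N k) / (1 - skewRoot N k)) := by
  have hN : 0 < N := by omega
  have hz := skewRoot_pow hN k
  have h0 : 1 - skewRoot N k ≠ 0 := by
    rw [sub_ne_zero]
    intro h
    rw [← h, one_pow] at hz
    norm_num at hz
  have h1 : ∀ i ∈ Finset.range N, ∑ j ∈ Finset.range N, starRingEnd ℂ (skewRoot N k ^ i) *
      ((if i < j then 1 else if j < i then -1 else 0 : ℝ) : ℂ) * skewRoot N k ^ j
      = (1 + skewRoot N k) / (1 - skewRoot N k) := fun i hi => by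
    have h2 := one_sub_mul_sum_sign_mul_pow hz (Finset.mem_range.1 hi)
    have h3 : starRingEnd ℂ (skewRoot N k ^ i) * skewRoot N k ^ i = 1 := by
      rw [← Complex.normSq_eq_conj_mul_self, Complex.normSq_eq_norm_sq, norm_pow, norm_skewRoot]
      simp
    rw [eq_div_iff h0]
    simp only [mul_assoc, ← Finset.mul_sum]
    simp only [apply_ite Complex.ofReal, Complex.ofReal_one, Complex.ofReal_neg,
      Complex.ofReal_zero]
    linear_combination (starRingEnd ℂ (skewRoot N k ^ i)) * h2 + (1 + skewRoot N k) * h3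
  rw [Finset.sum_congr rfl h1]
  simp

/-- For widely separated eigenvalues the multiplier degenerates to triangular truncation. -/
theorem tendsto_pow_sub_div_pow_add (i j : ℕ) :
    Tendsto (fun t : ℝ => (t ^ i - t ^ j) / (t ^ i + t ^ j)) (𝓝[>] 0)
      (𝓝 (if i < j then 1 else if j < i then -1 else 0)) := by
  have key : ∀ m : ℕ, Tendsto (fun t : ℝ => (1 - t ^ (m + 1)) / (1 + t ^ (m + 1))) (𝓝[>] 0)
      (𝓝 1) := fun m => by
    have : ContinuousAt (fun t : ℝ => (1 - t ^ (m + 1)) / (1 + t ^ (m + 1))) 0 :=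
      ContinuousAt.div (by fun_prop) (by fun_prop) (by simp)
    have h := this.tendsto.mono_left (nhdsWithin_le_nhds (s := Set.Ioi 0))
    simpa using h
  have key2 : ∀ i m : ℕ, ∀ t : ℝ, 0 < t →
      (1 - t ^ (m + 1)) / (1 + t ^ (m + 1))
        = (t ^ i - t ^ (i + m + 1)) / (t ^ i + t ^ (i + m + 1)) := fun i m t ht => by
    have h : t ^ i ≠ 0 := by positivity
    rw [← mul_div_mul_left _ _ h]
    ring_nf
  rcases lt_trichotomy i j with h | h | h
  · rw [if_pos h]
    obtain ⟨m, rfl⟩ := Nat.exists_eq_add_of_lt h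
    refine (key m).congr' ?_
    filter_upwards [self_mem_nhdsWithin] with t ht using key2 i m t ht
  · subst h
    simp
  · rw [if_neg h.not_gt, if_pos h]
    obtain ⟨m, rfl⟩ := Nat.exists_eq_add_of_lt h
    refine (key m).neg.congr' ?_
    filter_upwards [self_mem_nhdsWithin] with t ht
    rw [key2 j m t ht, ← neg_div, neg_sub, add_comm (t ^ j)]

/-- The Schur multiplier `(tⁱ - tʲ) / (tⁱ + tʲ)` does not preserve trace norms uniformly in the size:
on a matrix of constant entries its trace norm exceeds any multiple of the original one. -/
theorem exists_le_sum_norm_schur (C : ℝ) : ∃ N : ℕ, 0 < N ∧ ∃ t : ℝ, 0 < t ∧ t ≤ 1 ∧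
    C * N ≤ ∑ k ∈ Finset.range N, ‖∑ i ∈ Finset.range N, ∑ j ∈ Finset.range N,
      starRingEnd ℂ (skewRoot N k ^ i) * (((t ^ i - t ^ j) / (t ^ i + t ^ j) : ℝ) : ℂ) *
        skewRoot N k ^ j‖ / N := by
  -- The eigenvalue bounds sum to `N / π` times the harmonic sum, minus `N`. The constant `C + 2`
  -- leaves `(C + 1) N`, a strict margin that survives at some small `t > 0`.
  obtain ⟨N, hNC, hN⟩ : ∃ N : ℕ, (C + 2) * Real.pi ≤ ∑ k ∈ Finset.range N, (1 / ((k : ℝ) + 1)) ∧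
      0 < N :=
    ((Real.tendsto_sum_range_one_div_nat_succ_atTop.eventually_ge_atTop _).and
      (eventually_gt_atTop 0)).exists
  have hN' : (0 : ℝ) < N := by exact_mod_cast hN
  refine ⟨N, hN, ?_⟩
  have hlim : Tendsto (fun t : ℝ => ∑ k ∈ Finset.range N, ‖∑ i ∈ Finset.range N,
      ∑ j ∈ Finset.range N, starRingEnd ℂ (skewRoot N k ^ i) *
        (((t ^ i - t ^ j) / (t ^ i + t ^ j) : ℝ) : ℂ) * skewRoot N k ^ j‖ / N) (𝓝[>] 0)
      (𝓝 (∑ k ∈ Finset.range N, ‖∑ i ∈ Finset.range N,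
      ∑ j ∈ Finset.range N, starRingEnd ℂ (skewRoot N k ^ i) *
        ((if i < j then 1 else if j < i then -1 else 0 : ℝ) : ℂ) * skewRoot N k ^ j‖ / N)) := by
    refine tendsto_finsetSum _ fun k _ => Tendsto.div_const (Tendsto.norm ?_) _
    refine tendsto_finsetSum _ fun i _ => tendsto_finsetSum _ fun j _ => ?_
    refine Tendsto.mul_const _ (Tendsto.const_mul _ ?_)
    exact (Complex.continuous_ofReal.tendsto _).comp (tendsto_pow_sub_div_pow_add i j)
  have hlarge : C * N < ∑ k ∈ Finset.range N, ‖∑ i ∈ Finset.range N,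
      ∑ j ∈ Finset.range N, starRingEnd ℂ (skewRoot N k ^ i) *
        ((if i < j then 1 else if j < i then -1 else 0 : ℝ) : ℂ) * skewRoot N k ^ j‖ / N := by
    have h1 : ∀ k ∈ Finset.range N, N / (Real.pi * (k + 1)) - 1 ≤ ‖∑ i ∈ Finset.range N,
      ∑ j ∈ Finset.range N, starRingEnd ℂ (skewRoot N k ^ i) *
        ((if i < j then 1 else if j < i then -1 else 0 : ℝ) : ℂ) * skewRoot N k ^ j‖ / N :=
      fun k hk => by
        rw [sum_conj_skewRoot_mul_sign (Finset.mem_range.1 hk), norm_mul, Complex.norm_natCast,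
          mul_div_cancel_left₀ _ hN'.ne']
        exact norm_one_add_div_one_sub_skewRoot (Finset.mem_range.1 hk)
    refine lt_of_lt_of_le ?_ (Finset.sum_le_sum h1)
    have h2 : ∑ k ∈ Finset.range N, ((N : ℝ) / (Real.pi * (k + 1)) - 1)
        = N / Real.pi * (∑ k ∈ Finset.range N, (1 / ((k : ℝ) + 1))) - N := by
      rw [Finset.sum_sub_distrib, Finset.mul_sum]
      simp [div_eq_mul_inv, mul_assoc, mul_comm, mul_left_comm]
    rw [h2]
    have h3 : (C + 2) * N ≤ N / Real.pi * (∑ k ∈ Finset.range N, (1 / ((k : ℝ) + 1))) := by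
      calc (C + 2) * N = N / Real.pi * ((C + 2) * Real.pi) := by field_simp
        _ ≤ _ := by gcongr
    linarith
  have h01 : ∀ᶠ t : ℝ in 𝓝[>] 0, t ∈ Set.Ioc (0 : ℝ) 1 := Ioc_mem_nhdsGT one_pos
  obtain ⟨t, ht, ht'⟩ := ((hlim.eventually_const_lt hlarge).and h01).exists
  exact ⟨t, ht'.1, ht'.2, ht.le⟩

/-- Parameters of a finite block: `N` eigenvalues `d i` repeated `m` times, entries `σ` of the
commutator, and an orthonormal system `u` detecting the trace norm of the second commutator. -/
theorem exists_block (n : ℕ) : ∃ (N m : ℕ) (d : ℕ → ℝ) (σ : ℝ) (u : ℕ → ℕ → ℂ),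
    (∀ i, 0 < d i) ∧ 0 < σ ∧ ∑ i ∈ Finset.range N, d i ≤ (1 / 2) ^ n ∧
    ∑ i ∈ Finset.range N, ∑ j ∈ Finset.range N, σ / (d i + d j) ≤ (1 / 2) ^ n ∧
    2 * m * σ * N ≤ (1 / 2) ^ n ∧
    (∀ k < N, ∀ l < N, ∑ j ∈ Finset.range N, starRingEnd ℂ (u k j) * u l j
      = if k = l then 1 else 0) ∧
    n ≤ m * ∑ k ∈ Finset.range N, ‖∑ i ∈ Finset.range N, ∑ j ∈ Finset.range N,
      starRingEnd ℂ (u k i) * ((σ * ((d i - d j) / (d i + d j)) : ℝ) : ℂ) * u k j‖ := by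
  -- The factor `2 * 2 ^ n` compensates `m σ N = 2⁻ⁿ / 2`, leaving exactly `n`.
  obtain ⟨N, hN, t, ht, ht1, hC⟩ := exists_le_sum_norm_schur (2 * n * 2 ^ n)
  have hN' : (0 : ℝ) < N := by exact_mod_cast hN
  set α : ℝ := (1 / 2) ^ n / N with hα
  have hαp : 0 < α := by positivity
  -- Many copies allow a small `σ`: the norm of `Q` on the block depends on `σ` alone, the trace
  -- norms on `m σ`.
  obtain ⟨m, hm⟩ := exists_nat_gt (∑ i ∈ Finset.range N, ∑ j ∈ Finset.range N,
    1 / (α * t ^ i + α * t ^ j))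
  have hm0 : (0 : ℝ) < m := lt_of_le_of_lt
    (Finset.sum_nonneg fun i _ => Finset.sum_nonneg fun j _ => by positivity) hm
  set σ : ℝ := (1 / 2) ^ n / (2 * m * N) with hσ
  have hσp : 0 < σ := by positivity
  have hN1 : (1 : ℝ) ≤ N := by exact_mod_cast hN
  refine ⟨N, m, fun i => α * t ^ i, σ, fun k j => ((Real.sqrt N)⁻¹ : ℝ) * skewRoot N k ^ j,
    fun i => by positivity, hσp, ?_, ?_, ?_, fun k hk l hl => ?_, ?_⟩
  · calc ∑ i ∈ Finset.range N, α * t ^ i ≤ ∑ i ∈ Finset.range N, α := by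
          refine Finset.sum_le_sum fun i _ => ?_
          exact mul_le_of_le_one_right hαp.le (pow_le_one₀ ht.le ht1)
      _ = (1 / 2) ^ n := by
          rw [Finset.sum_const, Finset.card_range, nsmul_eq_mul, hα]; field_simp
  · calc ∑ i ∈ Finset.range N, ∑ j ∈ Finset.range N, σ / (α * t ^ i + α * t ^ j)
        = σ * ∑ i ∈ Finset.range N, ∑ j ∈ Finset.range N, 1 / (α * t ^ i + α * t ^ j) := by
          simp only [Finset.mul_sum, mul_one_div]
      _ ≤ σ * m := by gcongr
      _ = (1 / 2) ^ n / (2 * N) := by rw [hσ]; field_simp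
      _ ≤ (1 / 2) ^ n := div_le_self (by positivity) (by linarith)
  · rw [hσ]
    apply le_of_eq
    field_simp
  · have h := sum_conj_skewRoot_pow_mul hk hl
    have h1 : ∀ j, starRingEnd ℂ (((Real.sqrt N)⁻¹ : ℝ) * skewRoot N k ^ j) *
        (((Real.sqrt N)⁻¹ : ℝ) * skewRoot N l ^ j)
        = (N : ℂ)⁻¹ * (starRingEnd ℂ (skewRoot N k ^ j) * skewRoot N l ^ j) := fun j => by
      have h2 : ((((Real.sqrt N)⁻¹ : ℝ)) : ℂ) * (((Real.sqrt N)⁻¹ : ℝ)) = (N : ℂ)⁻¹ := by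
        rw [← Complex.ofReal_mul, ← mul_inv, Real.mul_self_sqrt hN'.le]; simp
      rw [map_mul, Complex.conj_ofReal, ← h2]
      ring
    simp only [h1, ← Finset.mul_sum, h]
    have : (N : ℂ) ≠ 0 := by exact_mod_cast hN.ne'
    split_ifs <;> simp [this]
  · have h1 : ∀ k i j, starRingEnd ℂ (((Real.sqrt N)⁻¹ : ℝ) * skewRoot N k ^ i) *
        ((σ * ((α * t ^ i - α * t ^ j) / (α * t ^ i + α * t ^ j)) : ℝ) : ℂ) *
        (((Real.sqrt N)⁻¹ : ℝ) * skewRoot N k ^ j)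
        = ((σ / N : ℝ) : ℂ) * (starRingEnd ℂ (skewRoot N k ^ i) *
          (((t ^ i - t ^ j) / (t ^ i + t ^ j) : ℝ) : ℂ) * skewRoot N k ^ j) := fun k i j => by
      have h2 : ((((Real.sqrt N)⁻¹ : ℝ)) : ℂ) * (((Real.sqrt N)⁻¹ : ℝ)) = (N : ℂ)⁻¹ := by
        rw [← Complex.ofReal_mul, ← mul_inv, Real.mul_self_sqrt hN'.le]; simp
      have h3 : ((σ / N : ℝ) : ℂ) = σ * (N : ℂ)⁻¹ := by
        rw [Complex.ofReal_div, div_eq_mul_inv, Complex.ofReal_natCast]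
      rw [← mul_sub, ← mul_add, mul_div_mul_left _ _ hαp.ne', map_mul, Complex.conj_ofReal,
        Complex.ofReal_mul σ, h3, ← h2]
      ring
    simp only [h1, ← Finset.mul_sum, norm_mul, Complex.norm_real,
      Real.norm_of_nonneg (show 0 ≤ σ / N by positivity)]
    have h3 := mul_le_mul_of_nonneg_left hC (show (0 : ℝ) ≤ m * σ by positivity)
    have h4 : (m * σ) * (2 * n * 2 ^ n * N) = (n : ℝ) := by
      rw [hσ, one_div, inv_pow]
      field_simp
    rw [h4, ← Finset.sum_div] at h3
    refine h3.trans (le_of_eq ?_)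
    ring

end SkewCirculant

/-! ### Diagonal and off-diagonal block operators -/

section BlockOperators

open InnerProductSpace

variable {H : Type*} [NormedAddCommGroup H] [InnerProductSpace ℂ H]
  (w : Bool × ℕ × ℕ × ℕ → H) (N m : ℕ → ℕ) (d : ℕ → ℕ → ℝ) (s : Bool → ℝ) (x : ℕ → ℕ → ℕ → ℝ)

/-- The matrix unit of the block `n` at the place `(a, b)`, amplified `m n` times. -/
noncomputable def matrixUnit (n : ℕ) (a b : Bool × ℕ) : H →L[ℂ] H :=
  ∑ c ∈ Finset.range (m n), rankOne ℂ (w (a.1, n, a.2, c)) (w (b.1, n, b.2, c))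

variable {w}

theorem matrixUnit_apply (hw : Orthonormal ℂ w) (n n' : ℕ) (a b b' : Bool × ℕ) (c : ℕ) :
    matrixUnit w m n a b (w (b'.1, n', b'.2, c)) =
      if n = n' ∧ b = b' ∧ c < m n then w (a.1, n, a.2, c) else 0 := by
  obtain ⟨b1, b2⟩ := b
  obtain ⟨b1', b2'⟩ := b'
  simp only [matrixUnit, sum_apply, rankOne_apply,
    orthonormal_iff_ite.1 hw, Prod.mk.injEq, ite_smul, one_smul, zero_smul]
  split_ifs with h
  · obtain ⟨rfl, ⟨rfl, rfl⟩, h⟩ := h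
    simp [h]
  · refine Finset.sum_eq_zero fun k hk => if_neg fun h' => h ?_
    obtain ⟨h1, h2, h3, rfl⟩ := h'
    exact ⟨h2, ⟨h1, h3⟩, by simpa using hk⟩

/-- A partial isometry, by Pythagoras and Bessel; the bound does not depend on the number of copies.
-/
theorem norm_matrixUnit_le (hw : Orthonormal ℂ w) (n : ℕ) (a b : Bool × ℕ) :
    ‖matrixUnit w m n a b‖ ≤ 1 := by
  refine ContinuousLinearMap.opNorm_le_bound _ zero_le_one fun v => ?_
  have ho : ∀ a : Bool × ℕ, Orthonormal ℂ (fun c : ℕ => w (a.1, n, a.2, c)) := fun a =>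
    hw.comp _ fun c c' h => by simpa using h
  rw [one_mul]
  refine le_of_sq_le_sq ?_ (norm_nonneg _)
  refine le_trans (le_of_eq ?_) ((ho b).sum_inner_products_le v (s := Finset.range (m n)))
  simp only [matrixUnit, sum_apply, rankOne_apply]
  have h := (ho a).inner_sum (fun c => ⟪w (b.1, n, b.2, c), v⟫_ℂ)
    (fun c => ⟪w (b.1, n, b.2, c), v⟫_ℂ) (Finset.range (m n))
  rw [inner_self_eq_norm_sq_to_K] at h
  have h2 := congrArg Complex.re h
  simp only [Complex.re_sum, ← Complex.normSq_eq_conj_mul_self, Complex.ofReal_re,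
    Complex.normSq_eq_norm_sq] at h2
  rw [← h2]
  norm_cast

theorem isCompactOperator_matrixUnit (n : ℕ) (a b : Bool × ℕ) :
    IsCompactOperator (matrixUnit w m n a b) := by
  rw [matrixUnit]
  refine Submodule.sum_mem (compactOperator (RingHom.id ℂ) H H) fun c _ => ?_
  exact (isCompactOperator_of_locallyCompactSpace_dom
    (innerSL ℂ (w (b.1, n, b.2, c)))).clm_comp (ContinuousLinearMap.toSpanSingleton ℂ _)

variable (w)

/-- The diagonal operator of the block `n`. -/
noncomputable def diagBlock (n : ℕ) : H →L[ℂ] H :=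
  ∑ i ∈ Finset.range (N n), ∑ b : Bool, ((s b * d n i : ℝ) : ℂ) • matrixUnit w m n (b, i) (b, i)

/-- The diagonal operator with eigenvalues `s b * d n i`, `i < N n`, of multiplicity `m n`. -/
noncomputable def diagOp : H →L[ℂ] H := ∑' n, diagBlock w N m d s n

/-- The block `n` of an off-diagonal operator. -/
noncomputable def offDiagBlock (n : ℕ) : H →L[ℂ] H :=
  ∑ i ∈ Finset.range (N n), ∑ j ∈ Finset.range (N n),
    (x n i j : ℂ) • (matrixUnit w m n (true, i) (false, j) + matrixUnit w m n (false, i) (true, j))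

/-- The off-diagonal operator with entries `x n i j`. -/
noncomputable def offDiagOp : H →L[ℂ] H := ∑' n, offDiagBlock w N m x n

variable {w N m d s x}

theorem diagOp_apply (hw : Orthonormal ℂ w)
    (h : HasSum (diagBlock w N m d s) (diagOp w N m d s)) {n c : ℕ} (hc : c < m n)
    (a : Bool × ℕ) (ha : a.2 < N n) :
    diagOp w N m d s (w (a.1, n, a.2, c)) = ((s a.1 * d n a.2 : ℝ) : ℂ) • w (a.1, n, a.2, c) := by
  obtain ⟨b, i⟩ := a
  have h1 := h.mapL (ContinuousLinearMap.apply ℂ H (w (b, n, i, c)))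
  have h2 : ∀ k, diagBlock w N m d s k (w (b, n, i, c)) =
      if k = n then ((s b * d n i : ℝ) : ℂ) • w (b, n, i, c) else 0 := fun k => by
    have h3 : ∀ a : Bool × ℕ, matrixUnit w m k a a (w (b, n, i, c)) =
        if k = n ∧ a = (b, i) ∧ c < m k then w (a.1, k, a.2, c) else 0 := fun a =>
      matrixUnit_apply m hw k n a a (b, i) c
    simp only [diagBlock, sum_apply, smul_apply, h3]
    split_ifs with hk
    · subst hk
      rw [Finset.sum_eq_single i, Finset.sum_eq_single b]
      · simp [hc]
      · intro b' _ hb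
        simp [hb]
      · simp
      · intro i' _ hi
        simp [hi]
      · intro hi
        exact absurd (Finset.mem_range.2 ha) hi
    · simp [hk]
  simp only [ContinuousLinearMap.apply_apply, h2] at h1
  exact h1.unique (hasSum_ite_eq n _)

theorem diagOp_mul_matrixUnit (hw : Orthonormal ℂ w)
    (h : HasSum (diagBlock w N m d s) (diagOp w N m d s)) (n : ℕ) (a b : Bool × ℕ)
    (ha : a.2 < N n) :
    diagOp w N m d s * matrixUnit w m n a b
      = ((s a.1 * d n a.2 : ℝ) : ℂ) • matrixUnit w m n a b := by
  ext v
  simp only [matrixUnit, ContinuousLinearMap.mul_def, ContinuousLinearMap.comp_apply, sum_apply, smul_apply,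
    map_sum, Finset.smul_sum]
  refine Finset.sum_congr rfl fun c hc => ?_
  rw [rankOne_apply, map_smul, diagOp_apply hw h (Finset.mem_range.1 hc) a ha, smul_comm]

variable [CompleteSpace H]

theorem star_matrixUnit (m : ℕ → ℕ) (n : ℕ) (a b : Bool × ℕ) :
    star (matrixUnit w m n a b) = matrixUnit w m n b a := by
  simp [matrixUnit, star_sum, ContinuousLinearMap.star_eq_adjoint, adjoint_rankOne]

theorem matrixUnit_nonneg (m : ℕ → ℕ) (n : ℕ) (a : Bool × ℕ) : 0 ≤ matrixUnit w m n a a := by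
  refine Finset.sum_nonneg fun c _ => ?_
  rw [ContinuousLinearMap.nonneg_iff_isPositive]
  exact isPositive_rankOne_self _

theorem hasSum_diagOp (hw : Orthonormal ℂ w) (hd : ∀ n i, 0 < d n i) (hs : ∀ b, |s b| ≤ 1)
    (hsum : ∀ n, ∑ i ∈ Finset.range (N n), d n i ≤ (1 / 2) ^ n) :
    HasSum (diagBlock w N m d s) (diagOp w N m d s) := by
  refine Summable.hasSum (Summable.of_norm_bounded
    (summable_geometric_two.mul_left 2) fun n => ?_)
  have h1 : ∀ i b, ‖((s b * d n i : ℝ) : ℂ) • matrixUnit w m n (b, i) (b, i)‖ ≤ d n i :=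
    fun i b => by
      rw [norm_smul, Complex.norm_real, norm_mul, Real.norm_eq_abs, Real.norm_of_nonneg (hd n i).le]
      calc _ ≤ 1 * d n i * 1 :=
            mul_le_mul (mul_le_mul_of_nonneg_right (hs b) (hd n i).le)
              (norm_matrixUnit_le m hw _ _ _) (norm_nonneg _) (by simpa using (hd n i).le)
        _ = _ := by ring
  calc ‖diagBlock w N m d s n‖ ≤ ∑ i ∈ Finset.range (N n), ∑ b : Bool, d n i :=
        norm_sum_le_of_le _ fun i _ => norm_sum_le_of_le _ fun b _ => h1 i b
    _ = 2 * ∑ i ∈ Finset.range (N n), d n i := by simp [Finset.mul_sum]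
    _ ≤ 2 * (1 / 2) ^ n := by gcongr; exact hsum n

theorem hasSum_offDiagOp (hw : Orthonormal ℂ w) (hx : ∀ n i j, 0 ≤ x n i j)
    (hsum : ∀ n, ∑ i ∈ Finset.range (N n), ∑ j ∈ Finset.range (N n), x n i j ≤ (1 / 2) ^ n) :
    HasSum (offDiagBlock w N m x) (offDiagOp w N m x) := by
  refine Summable.hasSum (Summable.of_norm_bounded
    (summable_geometric_two.mul_left 2) fun n => ?_)
  have h1 : ∀ i j, ‖(x n i j : ℂ) • (matrixUnit w m n (true, i) (false, j) +
      matrixUnit w m n (false, i) (true, j))‖ ≤ 2 * x n i j := fun i j => by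
    rw [norm_smul, Complex.norm_real, Real.norm_of_nonneg (hx n i j), mul_comm]
    refine mul_le_mul_of_nonneg_right ((norm_add_le _ _).trans ?_) (hx n i j)
    linarith [norm_matrixUnit_le m hw n (true, i) (false, j),
      norm_matrixUnit_le m hw n (false, i) (true, j)]
  calc ‖offDiagBlock w N m x n‖
      ≤ ∑ i ∈ Finset.range (N n), ∑ j ∈ Finset.range (N n), 2 * x n i j :=
        norm_sum_le_of_le _ fun i _ => norm_sum_le_of_le _ fun j _ => h1 i j
    _ = 2 * ∑ i ∈ Finset.range (N n), ∑ j ∈ Finset.range (N n), x n i j := by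
        simp [Finset.mul_sum]
    _ ≤ 2 * (1 / 2) ^ n := by gcongr; exact hsum n

/-- No convergence is needed: `star` preserves summability both ways, and a non-summable `tsum` is
zero. -/
theorem isSelfAdjoint_diagOp : IsSelfAdjoint (diagOp w N m d s) := by
  rw [IsSelfAdjoint, diagOp, tsum_star]
  congr 1 with n : 1
  simp only [diagBlock, star_sum, star_smul, star_matrixUnit, Complex.star_def, Complex.conj_ofReal]

theorem isSelfAdjoint_offDiagOp (hx : ∀ n i j, x n i j = x n j i) :
    IsSelfAdjoint (offDiagOp w N m x) := by
  rw [IsSelfAdjoint, offDiagOp, tsum_star]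
  congr 1 with n : 1
  simp only [offDiagBlock, star_sum, star_smul, star_add, star_matrixUnit, Complex.star_def,
    Complex.conj_ofReal]
  rw [Finset.sum_comm]
  refine Finset.sum_congr rfl fun i _ => Finset.sum_congr rfl fun j _ => ?_
  rw [hx, add_comm]

theorem isCompactOperator_diagOp (h : HasSum (diagBlock w N m d s) (diagOp w N m d s)) :
    IsCompactOperator (diagOp w N m d s) := by
  refine isCompactOperator_of_tendsto h (Filter.Eventually.of_forall fun t => ?_)
  refine Submodule.sum_mem (compactOperator (RingHom.id ℂ) H H) fun n _ => ?_
  refine Submodule.sum_mem _ fun i _ => Submodule.sum_mem _ fun b _ => ?_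
  exact Submodule.smul_mem _ _ (isCompactOperator_matrixUnit m n _ _)

theorem diagOp_nonneg (hd : ∀ n i, 0 < d n i) (hs : ∀ b, 0 ≤ s b) : 0 ≤ diagOp w N m d s := by
  refine tsum_nonneg fun n => Finset.sum_nonneg fun i _ => Finset.sum_nonneg fun b _ => ?_
  have h := (ContinuousLinearMap.nonneg_iff_isPositive _).1 (matrixUnit_nonneg (w := w) m n (b, i))
  rw [ContinuousLinearMap.nonneg_iff_isPositive]
  refine h.smul_of_nonneg ?_
  exact RCLike.ofReal_nonneg.2 (mul_nonneg (hs b) (hd n i).le)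

theorem matrixUnit_mul_diagOp (hw : Orthonormal ℂ w)
    (h : HasSum (diagBlock w N m d s) (diagOp w N m d s)) (n : ℕ) (a b : Bool × ℕ)
    (hb : b.2 < N n) :
    matrixUnit w m n a b * diagOp w N m d s
      = ((s b.1 * d n b.2 : ℝ) : ℂ) • matrixUnit w m n a b := by
  have h1 := congrArg star (diagOp_mul_matrixUnit hw h n b a hb)
  rwa [star_mul, star_smul, star_matrixUnit, isSelfAdjoint_diagOp.star_eq, Complex.star_def,
    Complex.conj_ofReal] at h1

/-- The signs disappear from the square, so uniqueness of the positive square root identifies the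
absolute value in `abs_diagOp`. -/
theorem diagOp_mul_self (hw : Orthonormal ℂ w)
    (h : HasSum (diagBlock w N m d s) (diagOp w N m d s)) (hs : ∀ b, s b * s b = 1) :
    diagOp w N m d s * diagOp w N m d s = ∑' n, ∑ i ∈ Finset.range (N n), ∑ b : Bool,
      ((d n i * d n i : ℝ) : ℂ) • matrixUnit w m n (b, i) (b, i) := by
  have h1 := h.mul_left (diagOp w N m d s)
  rw [← h1.tsum_eq]
  congr 1 with n : 1
  rw [diagBlock, Finset.mul_sum]
  refine Finset.sum_congr rfl fun i hi => ?_
  rw [Finset.mul_sum]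
  refine Finset.sum_congr rfl fun b _ => ?_
  rw [mul_smul_comm, diagOp_mul_matrixUnit hw h n (b, i) (b, i) (Finset.mem_range.1 hi), smul_smul,
    ← Complex.ofReal_mul]
  congr 2
  linear_combination (d n i * d n i) * hs b

theorem abs_diagOp (hw : Orthonormal ℂ w) (hd : ∀ n i, 0 < d n i)
    (hsum : ∀ n, ∑ i ∈ Finset.range (N n), d n i ≤ (1 / 2) ^ n) (hs : ∀ b, s b * s b = 1) :
    CFC.abs (diagOp w N m d s) = diagOp w N m d 1 := by
  have h1 : HasSum (diagBlock w N m d s) (diagOp w N m d s) :=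
    hasSum_diagOp hw hd (fun b => abs_le_one_iff_mul_self_le_one.2 (hs b).le) hsum
  have h2 : HasSum (diagBlock w N m d 1) (diagOp w N m d 1) :=
    hasSum_diagOp hw hd (by simp) hsum
  refine CFC.sqrt_unique ?_ (diagOp_nonneg hd (by simp))
  rw [isSelfAdjoint_diagOp.star_eq, diagOp_mul_self hw h1 hs, diagOp_mul_self hw h2 (by simp)]

/-- The commutator of a diagonal and an off-diagonal operator. -/
theorem diagOp_mul_offDiagBlock_sub (hw : Orthonormal ℂ w)
    (h : HasSum (diagBlock w N m d s) (diagOp w N m d s)) (n : ℕ) :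
    diagOp w N m d s * offDiagBlock w N m x n - offDiagBlock w N m x n * diagOp w N m d s =
      ∑ i ∈ Finset.range (N n), ∑ j ∈ Finset.range (N n),
        (((x n i j * (s true * d n i - s false * d n j) : ℝ) : ℂ) •
            matrixUnit w m n (true, i) (false, j) +
          ((x n i j * (s false * d n i - s true * d n j) : ℝ) : ℂ) •
            matrixUnit w m n (false, i) (true, j)) := by
  simp only [offDiagBlock, Finset.mul_sum, Finset.sum_mul, ← Finset.sum_sub_distrib]
  refine Finset.sum_congr rfl fun i hi => Finset.sum_congr rfl fun j hj => ?_
  rw [Finset.mem_range] at hi hj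
  rw [mul_smul_comm, smul_mul_assoc, mul_add, add_mul,
    diagOp_mul_matrixUnit hw h n (true, i) (false, j) hi,
    diagOp_mul_matrixUnit hw h n (false, i) (true, j) hi,
    matrixUnit_mul_diagOp hw h n (true, i) (false, j) hj,
    matrixUnit_mul_diagOp hw h n (false, i) (true, j) hj]
  push_cast
  module

end BlockOperators

/-! ### Trace norms of the two commutators -/

section Counterexample

open InnerProductSpace

variable {H : Type*} [NormedAddCommGroup H] [InnerProductSpace ℂ H]
  {w : Bool × ℕ × ℕ × ℕ → H} {N m : ℕ → ℕ} {d : ℕ → ℕ → ℝ} {σ : ℕ → ℝ}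

theorem norm_sum_orthonormal {ι : Type*} {v : ι → H} (hv : Orthonormal ℂ v) (t : Finset ι) :
    ‖∑ i ∈ t, v i‖ = Real.sqrt t.card := by
  have h := hv.inner_sum (fun _ => 1) (fun _ => 1) t
  simp only [one_smul, map_one, mul_one, Finset.sum_const, nsmul_eq_mul] at h
  have h2 := inner_self_eq_norm_sq (𝕜 := ℂ) (∑ i ∈ t, v i)
  rw [h] at h2
  rw [eq_comm, Real.sqrt_eq_iff_mul_self_eq (by positivity) (norm_nonneg _), ← sq, ← h2]
  simp

/-- A matrix with all entries equal is of rank one, which bounds its trace norm. -/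
theorem traceNormLE_sum_matrixUnit (hw : Orthonormal ℂ w) (n : ℕ) (b b' : Bool) :
    TraceNormLE (∑ i ∈ Finset.range (N n), ∑ j ∈ Finset.range (N n),
      matrixUnit w m n (b, i) (b', j)) (m n * N n) := by
  have h1 : ∑ i ∈ Finset.range (N n), ∑ j ∈ Finset.range (N n), matrixUnit w m n (b, i) (b', j)
      = ∑ c ∈ Finset.range (m n), rankOne ℂ (∑ i ∈ Finset.range (N n), w (b, n, i, c))
        (∑ j ∈ Finset.range (N n), w (b', n, j, c)) := by
    simp only [matrixUnit, map_sum, sum_apply]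
    rw [Finset.sum_congr rfl fun i _ => Finset.sum_comm, Finset.sum_comm]
    refine Finset.sum_congr rfl fun c _ => Finset.sum_comm
  have h2 : ∀ b c, ‖∑ i ∈ Finset.range (N n), w (b, n, i, c)‖ = Real.sqrt (N n) := fun b c => by
    have ho : Orthonormal ℂ (fun i : ℕ => w (b, n, i, c)) :=
      hw.comp _ fun i i' h => by simpa using h
    simpa using norm_sum_orthonormal ho (Finset.range (N n))
  rw [h1]
  refine (TraceNormLE.sum _ fun c _ => traceNormLE_rankOne _ _).mono (le_of_eq ?_)
  simp [h2]

/-- The first commutator has finite trace norm. -/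
theorem traceNormLE_commutator [CompleteSpace H] (hw : Orthonormal ℂ w) (hd : ∀ n i, 0 < d n i)
    (hσ : ∀ n, 0 < σ n) (hm : ∀ n, 2 * m n * σ n * N n ≤ (1 / 2) ^ n) {s : Bool → ℝ}
    (hs : s true = 1) (hs' : s false = -1)
    (hA : HasSum (diagBlock w N m d s) (diagOp w N m d s))
    {x : ℕ → ℕ → ℕ → ℝ} (hx : ∀ n i j, x n i j = σ n / (d n i + d n j))
    (hQ : HasSum (offDiagBlock w N m x) (offDiagOp w N m x)) :
    TraceNormLE (diagOp w N m d s * offDiagOp w N m x - offDiagOp w N m x * diagOp w N m d s) 2 := by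
  refine TraceNormLE.hasSum (r := fun n => (1 / 2) ^ n) (fun n => ?_)
    ((hQ.mul_left _).sub (hQ.mul_right _)) hasSum_geometric_two
  rw [diagOp_mul_offDiagBlock_sub hw hA]
  have h1 : ∀ i j, x n i j * (s true * d n i - s false * d n j) = σ n := fun i j => by
    rw [hs, hs', hx]
    have := add_pos (hd n i) (hd n j)
    field_simp
    ring
  have h2 : ∀ i j, x n i j * (s false * d n i - s true * d n j) = -σ n := fun i j => by
    rw [hs, hs', hx]
    have := add_pos (hd n i) (hd n j)
    field_simp
    ring
  simp only [h1, h2, Finset.sum_add_distrib, ← Finset.smul_sum]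
  refine (((traceNormLE_sum_matrixUnit hw n _ _).smul _).add
    ((traceNormLE_sum_matrixUnit hw n _ _).smul _)).mono (le_trans (le_of_eq ?_) (hm n))
  simp only [Complex.norm_real, norm_neg, Real.norm_of_nonneg (hσ n).le]
  ring

/-- Orthonormal combinations inside the copies of a block. -/
theorem orthonormal_blockVector (hw : Orthonormal ℂ w) {n : ℕ} {u : ℕ → ℕ → ℂ}
    (hu : ∀ k < N n, ∀ l < N n, ∑ j ∈ Finset.range (N n), starRingEnd ℂ (u k j) * u l j
      = if k = l then 1 else 0) (b : Bool) :
    Orthonormal ℂ fun kc : Fin (N n) × Fin (m n) =>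
      ∑ j ∈ Finset.range (N n), u kc.1 j • w (b, n, j, kc.2) := by
  rw [orthonormal_iff_ite]
  rintro ⟨k, c⟩ ⟨l, c'⟩
  have ho : ∀ i j (c c' : ℕ), ⟪w (b, n, i, c), w (b, n, j, c')⟫_ℂ =
      if i = j ∧ c = c' then 1 else 0 := fun i j c c' => by
    rw [orthonormal_iff_ite.1 hw]
    simp
  simp only [sum_inner, inner_sum, inner_smul_left, inner_smul_right, ho]
  by_cases hc : c = c'
  · subst hc
    simp only [and_true, mul_ite, mul_one, mul_zero]
    have h1 : ∀ j ∈ Finset.range (N n), (u l j * ∑ i ∈ Finset.range (N n),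
        if i = j then starRingEnd ℂ (u k i) else 0) = starRingEnd ℂ (u k j) * u l j :=
      fun j hj => by rw [Finset.sum_ite_eq', if_pos hj, mul_comm]
    rw [Finset.sum_congr rfl h1, hu k k.2 l l.2]
    simp [Fin.ext_iff]
  · have hc' : (c : ℕ) ≠ c' := fun h => hc (Fin.ext h)
    simp [hc, hc']

/-- The second commutator has infinite trace norm. -/
theorem not_traceNormLE_commutator [CompleteSpace H] (hw : Orthonormal ℂ w) {u : ℕ → ℕ → ℕ → ℂ}
    (hu : ∀ n, ∀ k < N n, ∀ l < N n, ∑ j ∈ Finset.range (N n),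
      starRingEnd ℂ (u n k j) * u n l j = if k = l then 1 else 0)
    (hlarge : ∀ n : ℕ, n ≤ m n * ∑ k ∈ Finset.range (N n),
      ‖∑ i ∈ Finset.range (N n), ∑ j ∈ Finset.range (N n), starRingEnd ℂ (u n k i) *
        ((σ n * ((d n i - d n j) / (d n i + d n j)) : ℝ) : ℂ) * u n k j‖)
    (hP : HasSum (diagBlock w N m d 1) (diagOp w N m d 1))
    {x : ℕ → ℕ → ℕ → ℝ} (hx : ∀ n i j, x n i j = σ n / (d n i + d n j))
    (hQ : HasSum (offDiagBlock w N m x) (offDiagOp w N m x)) (r : ℝ) :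
    ¬ TraceNormLE (diagOp w N m d 1 * offDiagOp w N m x - offDiagOp w N m x * diagOp w N m d 1)
      r := by
  intro h
  obtain ⟨n, hn⟩ := exists_nat_gt r
  -- Testing between the `true` and `false` halves isolates one corner of block `n`; each of the `m
  -- n` copies contributes the same sum.
  have h1 := h.sum_le (orthonormal_blockVector (m := m) hw (hu n) true).isBesselWith
    (orthonormal_blockVector (m := m) hw (hu n) false).isBesselWith
  have h2 : ∀ (k : ℕ) (c : ℕ), c < m n →
      ⟪∑ i ∈ Finset.range (N n), u n k i • w (true, n, i, c),
        (diagOp w N m d 1 * offDiagOp w N m x - offDiagOp w N m x * diagOp w N m d 1)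
          (∑ j ∈ Finset.range (N n), u n k j • w (false, n, j, c))⟫_ℂ =
      ∑ i ∈ Finset.range (N n), ∑ j ∈ Finset.range (N n), starRingEnd ℂ (u n k i) *
        ((σ n * ((d n i - d n j) / (d n i + d n j)) : ℝ) : ℂ) * u n k j := fun k c hc => by
    have h3 := ((hQ.mul_left (diagOp w N m d 1)).sub (hQ.mul_right (diagOp w N m d 1))).mapL
      (ContinuousLinearMap.apply ℂ H (∑ j ∈ Finset.range (N n), u n k j • w (false, n, j, c)))
    have h4 : ∀ n' i j', matrixUnit w m n' (false, i) (true, j')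
        (∑ j ∈ Finset.range (N n), u n k j • w (false, n, j, c)) = 0 := fun n' i j' => by
      rw [map_sum]
      refine Finset.sum_eq_zero fun j _ => ?_
      rw [map_smul, matrixUnit_apply m hw n' n (false, i) (true, j') (false, j) c]
      simp
    have h4' : ∀ n' i j', matrixUnit w m n' (true, i) (false, j')
        (∑ j ∈ Finset.range (N n), u n k j • w (false, n, j, c)) =
        if n' = n ∧ j' < N n then u n k j' • w (true, n, i, c) else 0 := fun n' i j' => by
      rw [map_sum]
      have h : ∀ j, matrixUnit w m n' (true, i) (false, j') (u n k j • w (false, n, j, c)) =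
          if j' = j then (if n' = n then u n k j' • w (true, n, i, c) else 0) else 0 := fun j => by
        rw [map_smul, matrixUnit_apply m hw n' n (true, i) (false, j') (false, j) c]
        by_cases h1 : n' = n
        · subst h1
          by_cases h2 : j' = j <;> simp [h2, hc]
        · simp [h1]
      rw [Finset.sum_congr rfl fun j _ => h j, Finset.sum_ite_eq]
      simp only [Finset.mem_range, ite_and]
      split_ifs <;> rfl
    have h5 : ∀ n', (diagOp w N m d 1 * offDiagBlock w N m x n' -
        offDiagBlock w N m x n' * diagOp w N m d 1)
          (∑ j ∈ Finset.range (N n), u n k j • w (false, n, j, c)) =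
        if n' = n then ∑ i ∈ Finset.range (N n), ∑ j ∈ Finset.range (N n),
          (((σ n * ((d n i - d n j) / (d n i + d n j)) : ℝ) : ℂ) * u n k j) •
            w (true, n, i, c) else 0 := fun n' => by
      simp only [diagOp_mul_offDiagBlock_sub hw hP, sum_apply, add_apply, smul_apply, h4, h4',
        smul_zero, add_zero]
      split_ifs with hn'
      · subst hn'
        refine Finset.sum_congr rfl fun i _ => Finset.sum_congr rfl fun j hj => ?_
        rw [if_pos ⟨rfl, Finset.mem_range.1 hj⟩, smul_smul, hx]
        congr 3
        simp only [Pi.one_apply, one_mul]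
        ring
      · simp [hn']
    simp only [ContinuousLinearMap.apply_apply, h5] at h3
    rw [h3.unique (hasSum_ite_eq n _), sum_inner]
    have ho : Orthonormal ℂ (fun i : ℕ => w (true, n, i, c)) :=
      hw.comp _ fun i i' h => by simpa using h
    refine Finset.sum_congr rfl fun i hi => ?_
    simp only [← Finset.sum_smul]
    rw [inner_smul_left, ho.inner_right_sum _ hi, Finset.mul_sum]
    simp only [mul_assoc]
  have h6 : ∑ kc : Fin (N n) × Fin (m n),
      ‖⟪∑ i ∈ Finset.range (N n), u n kc.1 i • w (true, n, i, kc.2),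
        (diagOp w N m d 1 * offDiagOp w N m x - offDiagOp w N m x * diagOp w N m d 1)
          (∑ j ∈ Finset.range (N n), u n kc.1 j • w (false, n, j, kc.2))⟫_ℂ‖ =
      m n * ∑ k ∈ Finset.range (N n),
      ‖∑ i ∈ Finset.range (N n), ∑ j ∈ Finset.range (N n), starRingEnd ℂ (u n k i) *
        ((σ n * ((d n i - d n j) / (d n i + d n j)) : ℝ) : ℂ) * u n k j‖ := by
    rw [Fintype.sum_prod_type, Finset.sum_congr rfl fun k _ => Finset.sum_congr rfl fun c _ => by
      rw [h2 k c c.2]]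
    rw [← Fin.sum_univ_eq_sum_range (fun k => ‖∑ i ∈ Finset.range (N n),
      ∑ j ∈ Finset.range (N n), starRingEnd ℂ (u n k i) *
        ((σ n * ((d n i - d n j) / (d n i + d n j)) : ℝ) : ℂ) * u n k j‖)]
    simp [Finset.mul_sum]
  rw [h6] at h1
  have := hlarge n
  linarith

/-- Separability is not needed: a countable orthonormal family carries the construction, and the
block operators vanish on its orthogonal complement. -/
theorem exists_orthonormal_of_not_finiteDimensional [CompleteSpace H]
    (hH : ¬ FiniteDimensional ℂ H) (ι : Type*) [Countable ι] : ∃ w : ι → H, Orthonormal ℂ w := by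
  obtain ⟨s, b, -⟩ := exists_hilbertBasis ℂ H
  have hs : Infinite s := by
    by_contra h
    rw [not_infinite_iff_finite] at h
    have := Fintype.ofFinite s
    exact hH b.toOrthonormalBasis.toBasis.finiteDimensional_of_finite
  obtain ⟨f, hf⟩ := exists_injective_nat ι
  exact ⟨_, b.orthonormal.comp _ ((Infinite.natEmbedding s).injective.comp hf)⟩

end Counterexample

theorem mainTheorem4 {H : Type*} [NormedAddCommGroup H] [InnerProductSpace ℂ H] [CompleteSpace H]
    (hH : ¬ FiniteDimensional ℂ H) :
    ∃ A B : H →L[ℂ] H,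
      IsCompactOperator A ∧ IsSelfAdjoint A ∧ IsCompactOperator B ∧ IsSelfAdjoint B ∧
        IsTraceClass (A - B) ∧ ¬ IsTraceClass (CFC.abs A - CFC.abs B) := by
  obtain ⟨w, hw⟩ := exists_orthonormal_of_not_finiteDimensional hH (Bool × ℕ × ℕ × ℕ)
  choose N m d σ u hd hσ hdsum hxsum hm hu hlarge using exists_block
  -- Chosen to solve `x (d i + d j) = σ`, which makes the entries of `[A, Q]` constant up to sign.
  let x : ℕ → ℕ → ℕ → ℝ := fun n i j => σ n / (d n i + d n j)
  let s : Bool → ℝ := fun b => if b then 1 else -1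
  have hs : ∀ b, s b * s b = 1 := by simp [s]
  have hA := hasSum_diagOp (m := m) hw hd (fun b => abs_le_one_iff_mul_self_le_one.2 (hs b).le)
    hdsum
  have hP := hasSum_diagOp (m := m) (s := 1) hw hd (by simp) hdsum
  have hQ := hasSum_offDiagOp (m := m) (x := x) hw
    (fun n i j => (div_pos (hσ n) (add_pos (hd n i) (hd n j))).le) hxsum
  obtain ⟨B, h⟩ := exists_isTraceClass_sub_of_commutator isSelfAdjoint_diagOp
    (isCompactOperator_diagOp hA) (abs_diagOp hw hd hdsum hs)
    (isSelfAdjoint_offDiagOp fun n i j => by simp only [add_comm])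
    (traceNormLE_commutator hw hd hσ hm (by simp [s]) (by simp [s]) hA (fun _ _ _ => rfl) hQ)
    (not_traceNormLE_commutator hw hu hlarge hP (fun _ _ _ => rfl) hQ)
  exact ⟨_, B, isCompactOperator_diagOp hA, isSelfAdjoint_diagOp, h⟩
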